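/- All graphs are finite and simple. For a graph $G$, let $i_k(G)$ be the number of independent sets of cardinality $k$ in $G$, let $\alpha(G)$ be the largest cardinality of an independent set, and let $I(G;x)=\sum_{k=0}^{\alpha(G)} i_k(G)x^k$ be the independence polynomial of $G$. A clique cover of $G$ is a spanning subgraph $\mathscr{C}$ of $G$ each of whose components is a clique; these components $C_1,\dots,C_q$ are called the cliques of $\mathscr{C}$. For a graph $H'$ and a subset $U\subseteq V(H')$, the clique cover product $G^{\mathscr{C}}\star H'^{\,U}$ is the graph obtained from $G$ by adding, for each clique $C_i$ of $\mathscr{C}$, a copy of $H'$ and joining every vertex of $C_i$ to every vertex of $U$ in this copy. For a graph $H$ with root $v\in V(H)$, the rooted product $G\,\overline{\circ}\,H$ is obtained by taking one copy of $H$ for each vertex of $G$ and joining the roots of two copies whenever the corresponding vertices of $G$ are adjacent. A graph is claw-free if it has no induced subgraph isomorphic to $K_{1,3}$. A real polynomial has only real zeros if all its complex zeros are real. **Proposition.** Let $G$ be a graph such that $I(G;x)$ has only real zeros, let $H$ be a claw-free graph with root $v\in V(H)$, and let $U=N(v)$ be the set of neighbours of $v$ in $H$. Then, for every clique cover $\mathscr{C}$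 of $G$, the polynomial $I\bigl(G^{\mathscr{C}}\star (H-v)^U;x\bigr)$ has only real zeros. In particular, $I(G\,\overline{\circ}\,H;x)$ has only real zeros. -/

import Mathlib

namespace SimpleGraph

/-- The number `i_k(G)` of independent sets of cardinality `k` in `G`. -/
noncomputable def indepCount {V : Type*} (G : SimpleGraph V) (k : ℕ) : ℕ :=
  {s : Finset V | G.IsNIndepSet k s}.ncard

/-- The independence polynomial `I(G; x) = ∑_{k = 0}^{α(G)} i_k(G) x^k` of a finite graph. -/
noncomputable def indepPoly {V : Type*} (G : SimpleGraph V) : Polynomial ℝ :=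
  ∑ k ∈ Finset.range (G.indepNum + 1),
    Polynomial.C (G.indepCount k : ℝ) * Polynomial.X ^ k

/-- A graph is claw-free if it has no induced subgraph isomorphic to the claw `K_{1,3}`. -/
def ClawFree {V : Type*} (G : SimpleGraph V) : Prop :=
  ¬ (completeBipartiteGraph (Fin 1) (Fin 3)).IsIndContained G

/-- A clique cover of `G`: a spanning subgraph of `G` each of whose components is a clique
(a complete graph). -/
structure CliqueCover {V : Type*} (G : SimpleGraph V) where
  /-- the spanning subgraph -/
  graph : SimpleGraph V
  le : graph ≤ G
  isClique : ∀ c : graph.ConnectedComponent, graph.IsClique c.supp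

/-- The set of cliques of a clique cover, that is, of components of the spanning subgraph. -/
abbrev CliqueCover.Cliques {V : Type*} {G : SimpleGraph V} (K : G.CliqueCover) : Type _ :=
  K.graph.ConnectedComponent

/-- The clique cover product of `G`, with clique cover `K`, and `H`, with vertex subset `U`: take
`G` and one copy of `H` for each clique `c` of `K`, and join every vertex of `c` to every vertex
of `U` in the copy of `H` that belongs to `c`. -/
def cliqueCoverProduct {V W : Type*} (G : SimpleGraph V) (K : G.CliqueCover)
    (H : SimpleGraph W) (U : Set W) : SimpleGraph (V ⊕ K.Cliques × W) where
  Adj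
    | Sum.inl a, Sum.inl b => G.Adj a b
    | Sum.inl a, Sum.inr (c, x) => a ∈ c.supp ∧ x ∈ U
    | Sum.inr (c, x), Sum.inl a => a ∈ c.supp ∧ x ∈ U
    | Sum.inr (c, x), Sum.inr (d, y) => c = d ∧ H.Adj x y
  symm := ⟨by
    rintro (a | ⟨c, x⟩) (b | ⟨d, y⟩) h
    · exact G.symm.symm _ _ h
    · exact h
    · exact h
    · exact ⟨h.1.symm, H.symm.symm _ _ h.2⟩⟩
  loopless := ⟨by
    rintro (a | ⟨c, x⟩) h
    · exact G.loopless.irrefl _ h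
    · exact H.loopless.irrefl _ h.2⟩

/-- The rooted product of `G` and the graph `H` with root `v`: take one copy of `H` for each
vertex of `G`, and join the roots of two copies when the two vertices of `G` are adjacent. -/
def rootedProduct {V W : Type*} (G : SimpleGraph V) (H : SimpleGraph W) (v : W) :
    SimpleGraph (V × W) where
  Adj p q := (G.Adj p.1 q.1 ∧ p.2 = v ∧ q.2 = v) ∨ (p.1 = q.1 ∧ H.Adj p.2 q.2)
  symm := ⟨by
    rintro p q (⟨h, hp, hq⟩ | ⟨h, h'⟩)
    · exact Or.inl ⟨h.symm, hq, hp⟩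
    · exact Or.inr ⟨h.symm, h'.symm⟩⟩
  loopless := ⟨by
    rintro p (⟨h, -, -⟩ | ⟨-, h⟩)
    · exact G.loopless.irrefl _ h
    · exact H.loopless.irrefl _ h⟩

end SimpleGraph

/-- A real polynomial has only real zeros if each of its complex zeros is real. -/
def Polynomial.HasOnlyRealZeros (p : Polynomial ℝ) : Prop :=
  ∀ z : ℂ, Polynomial.aeval z p = 0 → z.im = 0

/-!
Independence polynomials of clique cover products with a claw-free graph.

Write `p = I(H - v)`, `q = I(H - N[v])` and let `c` be the number of cliques of the cover. An
independent set `S` of `G` meets each clique at most once, so it leaves `q` for `#S` of the copies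
of `H - v` and `p` for the others, and the independence polynomial of the product at `x` is
`p(x) ^ c * I(G; x q(x) / p(x))`. At a nonreal `x` the claw-free graph `H - v` has `p(x) ≠ 0`, so a
zero there makes `r = x q(x) / p(x)` a zero of `I(G)`, which is real, hence negative. Then
`p(x) + (-1 / r) x q(x) = 0`: the independence polynomial of `H` in which `v` carries the positive
weight `-1 / r` vanishes at `x`. The rooted product is the case of the cover by single vertices.

So everything rests on the weighted form of the theorem of Chudnovsky and Seymour
(`SimpleGraph.ClawFree.indepSum_ne_zero`): for a claw-free graph and positive vertex weights,
`I(z²) ≠ 0` whenever `Re z ≠ 0`. The argument expands `|I(z²)|²` as a sum with nonnegative terms.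
The product `I(x) I(y)` is a sum over pairs `(S, T)` of independent sets; group the pairs by their
union `M`. The part `f(M)` of `M` is multiplicative over the connected components of `M`, and if `M`
is connected, then `#S` and `#T` differ by at most one, since `S ∪ T` induces a graph of
maximum degree two. Hence replacing `(x, y) = (z², z̄²)` by `(-|z|², -|z|²)`, which keeps `x y` and
changes `x + y` by `(2 Re z)²`, changes the part of a connected `M` by a nonnegative amount.
Expanding the product over the components gives
`|I(z²)|² = ∑ Q, E(Q) * I(G - N[Q]; -|z|²)²` with `E ≥ 0`, and a maximal independent set `Q`
contributes a positive term. The function `E` is called `SimpleGraph.excess` below; it is defined by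
inversion, which avoids handling the components one by one.
-/

namespace SimpleGraph

open Finset
open scoped ComplexConjugate ComplexOrder

/-! ### Pairs of independent sets and separated decompositions -/

section Separated

variable {V R : Type*} [CommRing R]

open scoped Classical in
/-- The multivariate independence sum of the subgraph induced on `U`: the sum over the independent
sets `S ⊆ U` of `∏ v ∈ S, y v`. -/
noncomputable def indepSum (G : SimpleGraph V) (y : V → R) (U : Finset V) : R :=
  ∑ S ∈ U.powerset.filter fun S : Finset V => G.IsIndepSet (S : Set V), ∏ v ∈ S, y v

/-- Two vertex sets are separated if they are disjoint and no edge joins them. -/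
def Separated (G : SimpleGraph V) (A B : Finset V) : Prop :=
  ∀ a ∈ A, ∀ b ∈ B, a ≠ b ∧ ¬ G.Adj a b

variable {G : SimpleGraph V} {A B C : Finset V}

lemma Separated.symm (h : G.Separated A B) : G.Separated B A :=
  fun b hb a ha => ⟨(h a ha b hb).1.symm, fun e => (h a ha b hb).2 e.symm⟩

lemma Separated.mono {A' B' : Finset V} (h : G.Separated A B) (hA : A' ⊆ A) (hB : B' ⊆ B) :
    G.Separated A' B' :=
  fun a ha b hb => h a (hA ha) b (hB hb)

lemma Separated.disjoint (h : G.Separated A B) : Disjoint A B :=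
  Finset.disjoint_left.2 fun a ha hb => (h a ha a hb).1 rfl

lemma IsIndepSet.anti {s t : Set V} (h : G.IsIndepSet t) (hst : s ⊆ t) : G.IsIndepSet s :=
  Set.Pairwise.mono hst h

variable [DecidableEq V]

lemma separated_union_left : G.Separated (A ∪ B) C ↔ G.Separated A C ∧ G.Separated B C := by
  constructor
  · exact fun h => ⟨h.mono subset_union_left subset_rfl, h.mono subset_union_right subset_rfl⟩
  · rintro ⟨h, h'⟩ a ha b hb
    rcases mem_union.1 ha with ha | ha
    exacts [h a ha b hb, h' a ha b hb]

lemma separated_union_right : G.Separated A (B ∪ C) ↔ G.Separated A B ∧ G.Separated A C := by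
  constructor
  · exact fun h => ⟨h.mono subset_rfl subset_union_left, h.mono subset_rfl subset_union_right⟩
  · rintro ⟨h, h'⟩ a ha b hb
    rcases mem_union.1 hb with hb | hb
    exacts [h a ha b hb, h' a ha b hb]

lemma Separated.isIndepSet_union (h : G.Separated A B) (hA : G.IsIndepSet (A : Set V))
    (hB : G.IsIndepSet (B : Set V)) : G.IsIndepSet ((A ∪ B : Finset V) : Set V) := by
  intro a ha b hb hab
  rw [mem_coe, mem_union] at ha hb
  rcases ha with ha | ha <;> rcases hb with hb | hb
  · exact hA ha hb hab
  · exact (h a ha b hb).2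
  · exact (h.symm a ha b hb).2
  · exact hB ha hb hab

open scoped Classical in
/-- The part of the product of two independence sums that comes from the pairs of independent sets
with union `M`. -/
noncomputable def pairSum (G : SimpleGraph V) (y y' : V → R) (M : Finset V) : R :=
  ∑ p ∈ (M.powerset ×ˢ M.powerset).filter fun p : Finset V × Finset V =>
      (G.IsIndepSet (p.1 : Set V) ∧ G.IsIndepSet (p.2 : Set V)) ∧ p.1 ∪ p.2 = M,
    (∏ v ∈ p.1, y v) * ∏ v ∈ p.2, y' v

lemma indepSum_mul_indepSum (y y' : V → R) (U : Finset V) :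
    G.indepSum y U * G.indepSum y' U = ∑ M ∈ U.powerset, G.pairSum y y' M := by
  classical
  rw [indepSum, indepSum, sum_mul_sum, ← sum_product',
    ← sum_fiberwise_of_maps_to (g := fun p : Finset V × Finset V => p.1 ∪ p.2) (t := U.powerset)]
  · refine sum_congr rfl fun M hM => sum_congr ?_ fun _ _ => rfl
    ext ⟨S, T⟩
    simp only [mem_filter, mem_product, mem_powerset] at hM ⊢
    constructor
    · rintro ⟨⟨⟨-, hS⟩, -, hT⟩, rfl⟩
      exact ⟨⟨subset_union_left, subset_union_right⟩, ⟨hS, hT⟩, rfl⟩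
    · rintro ⟨⟨h1, h2⟩, ⟨hS, hT⟩, rfl⟩
      exact ⟨⟨⟨h1.trans hM, hS⟩, h2.trans hM, hT⟩, rfl⟩
  · rintro ⟨S, T⟩ h
    simp only [mem_filter, mem_product, mem_powerset] at h ⊢
    exact union_subset h.1.1 h.2.1

lemma pairSum_empty (y y' : V → R) : G.pairSum y y' ∅ = 1 := by
  classical
  rw [pairSum, sum_eq_single (∅, ∅)]
  · simp
  · rintro ⟨S, T⟩ h h'
    simp only [mem_filter, mem_product, powerset_empty, mem_singleton] at h
    exact absurd (Prod.ext h.1.1 h.1.2) h'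
  · intro h
    refine absurd ?_ h
    simp

lemma pairSum_union (y y' : V → R) (h : G.Separated A B) :
    G.pairSum y y' (A ∪ B) = G.pairSum y y' A * G.pairSum y y' B := by
  classical
  have hd := h.disjoint
  rw [pairSum, pairSum, pairSum, sum_mul_sum, ← sum_product']
  refine sum_nbij' (fun p => ((p.1 ∩ A, p.2 ∩ A), (p.1 ∩ B, p.2 ∩ B)))
    (fun q => (q.1.1 ∪ q.2.1, q.1.2 ∪ q.2.2)) ?_ ?_ ?_ ?_ ?_
  · rintro ⟨S, T⟩ hp
    simp only [mem_filter, mem_product, mem_powerset] at hp ⊢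
    obtain ⟨-, ⟨hS, hT⟩, hu⟩ := hp
    refine ⟨⟨⟨inter_subset_right, inter_subset_right⟩, ⟨hS.anti ?_, hT.anti ?_⟩, ?_⟩,
      ⟨inter_subset_right, inter_subset_right⟩, ⟨hS.anti ?_, hT.anti ?_⟩, ?_⟩
    · exact_mod_cast inter_subset_left
    · exact_mod_cast inter_subset_left
    · rw [← union_inter_distrib_right, hu, union_inter_cancel_left]
    · exact_mod_cast inter_subset_left
    · exact_mod_cast inter_subset_left
    · rw [← union_inter_distrib_right, hu, union_inter_cancel_right]
  · rintro ⟨⟨S, T⟩, S', T'⟩ hp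
    simp only [mem_filter, mem_product, mem_powerset] at hp ⊢
    obtain ⟨⟨⟨h1, h2⟩, ⟨hS, hT⟩, rfl⟩, ⟨h1', h2'⟩, ⟨hS', hT'⟩, rfl⟩ := hp
    refine ⟨⟨union_subset_union h1 h1', union_subset_union h2 h2'⟩,
      ⟨(h.mono h1 h1').isIndepSet_union hS hS', (h.mono h2 h2').isIndepSet_union hT hT'⟩, ?_⟩
    exact union_union_union_comm _ _ _ _
  · rintro ⟨S, T⟩ hp
    simp only [mem_filter, mem_product, mem_powerset] at hp
    simp only [← inter_union_distrib_left, inter_eq_left.2 hp.1.1, inter_eq_left.2 hp.1.2]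
  · rintro ⟨⟨S, T⟩, S', T'⟩ hp
    simp only [mem_filter, mem_product, mem_powerset] at hp
    obtain ⟨⟨⟨h1, h2⟩, -⟩, ⟨h1', h2'⟩, -⟩ := hp
    have e1 : ∀ X Y : Finset V, X ⊆ A → Y ⊆ B → (X ∪ Y) ∩ A = X ∧ (X ∪ Y) ∩ B = Y := by
      intro X Y hX hY
      rw [union_inter_distrib_right, union_inter_distrib_right, inter_eq_left.2 hX,
        inter_eq_left.2 hY, disjoint_iff_inter_eq_empty.1 (hd.symm.mono_left hY),
        disjoint_iff_inter_eq_empty.1 (hd.mono_left hX)]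
      simp
    simp only [e1 _ _ h1 h1', e1 _ _ h2 h2']
  · rintro ⟨S, T⟩ hp
    simp only [mem_filter, mem_product, mem_powerset] at hp
    have e : ∀ (X : Finset V) (u : V → R), X ⊆ A ∪ B →
        ∏ v ∈ X, u v = (∏ v ∈ X ∩ A, u v) * ∏ v ∈ X ∩ B, u v := by
      intro X u hX
      rw [← prod_union (hd.mono inter_subset_right inter_subset_right),
        ← inter_union_distrib_left, inter_eq_left.2 hX]
    simp only []
    rw [e S y hp.1.1, e T y' hp.1.2]
    ring

open scoped Classical in
/-- The function `E` determined by `f M = ∑ Q, E Q * g (M \ Q)`, where `Q` runs over the subsets of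
`M` that are separated from their complement in `M` (see `sum_excess_mul`). -/
noncomputable def excess (G : SimpleGraph V) (f g : Finset V → R) : Finset V → R :=
  Finset.strongInduction fun M E =>
    f M - ∑ Q ∈ M.ssubsets.attach,
      if G.Separated Q.1 (M \ Q.1) then E Q.1 (mem_ssubsets.1 Q.2) * g (M \ Q.1) else 0

open scoped Classical in
lemma sum_excess_mul {f g : Finset V → R} (hg : g ∅ = 1) (M : Finset V) :
    ∑ Q ∈ M.powerset with G.Separated Q (M \ Q), G.excess f g Q * g (M \ Q) = f M := by
  have h1 : G.excess f g M = f M - ∑ Q ∈ M.ssubsets.attach,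
      if G.Separated Q.1 (M \ Q.1) then G.excess f g Q.1 * g (M \ Q.1) else 0 := by
    rw [excess, Finset.strongInduction_eq]
  rw [sum_attach M.ssubsets (fun Q =>
    if G.Separated Q (M \ Q) then G.excess f g Q * g (M \ Q) else 0)] at h1
  rw [sum_filter, ← Finset.insert_erase (mem_powerset_self M), sum_insert (notMem_erase _ _)]
  rw [ssubsets] at h1
  simp only [sdiff_self]
  rw [if_pos (by intro a _ b hb; simp at hb), show g ⊥ = 1 from hg, h1]
  ring

/-- If `f` and `g` are multiplicative over separated unions, then so is the excess. -/
lemma excess_union {f g : Finset V → R} (hg : g ∅ = 1)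
    (hfm : ∀ A B, G.Separated A B → f (A ∪ B) = f A * f B)
    (hgm : ∀ A B, G.Separated A B → g (A ∪ B) = g A * g B) (h : G.Separated A B) :
    G.excess f g (A ∪ B) = G.excess f g A * G.excess f g B := by
  classical
  induction hn : #(A ∪ B) using Nat.strong_induction_on generalizing A B with
  | _ n ih =>
  subst hn
  have hd := h.disjoint
  -- the separated subsets of `A ∪ B` are the unions of separated subsets of `A` and of `B`
  have key : f (A ∪ B) = ∑ p ∈ ({Q ∈ A.powerset | G.Separated Q (A \ Q)} ×ˢ
      {Q ∈ B.powerset | G.Separated Q (B \ Q)}),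
        G.excess f g (p.1 ∪ p.2) * (g (A \ p.1) * g (B \ p.2)) := by
    have e2 : ∀ X Y : Finset V, X ⊆ A → Y ⊆ B → (A ∪ B) \ (X ∪ Y) = (A \ X) ∪ (B \ Y) := by
      intro X Y hX hY
      ext a
      have : a ∈ A → a ∉ B := fun h1 => Finset.disjoint_left.1 hd h1
      have := @hX a
      have := @hY a
      simp only [mem_union, mem_sdiff]
      tauto
    rw [← sum_excess_mul (G := G) (f := f) hg (A ∪ B)]
    refine sum_nbij' (fun Q => (Q ∩ A, Q ∩ B)) (fun p => p.1 ∪ p.2) ?_ ?_ ?_ ?_ ?_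
    · intro Q hQ
      simp only [mem_filter, mem_product, mem_powerset] at hQ ⊢
      refine ⟨⟨inter_subset_right, hQ.2.mono inter_subset_left ?_⟩,
        inter_subset_right, hQ.2.mono inter_subset_left ?_⟩ <;>
      · intro a ha
        simp only [mem_sdiff, mem_inter, mem_union] at ha ⊢
        tauto
    · rintro ⟨X, Y⟩ hp
      simp only [mem_filter, mem_product, mem_powerset] at hp ⊢
      obtain ⟨⟨hX, hX'⟩, hY, hY'⟩ := hp
      refine ⟨union_subset_union hX hY, ?_⟩
      rw [e2 X Y hX hY, separated_union_left, separated_union_right, separated_union_right]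
      exact ⟨⟨hX', h.mono hX sdiff_subset⟩, h.symm.mono hY sdiff_subset, hY'⟩
    · intro Q hQ
      simp only [mem_filter, mem_powerset] at hQ
      simp only [← inter_union_distrib_left, inter_eq_left.2 hQ.1]
    · rintro ⟨X, Y⟩ hp
      simp only [mem_filter, mem_product, mem_powerset] at hp
      obtain ⟨⟨hX, -⟩, hY, -⟩ := hp
      simp only [union_inter_distrib_right, inter_eq_left.2 hX,
        inter_eq_left.2 hY, disjoint_iff_inter_eq_empty.1 (hd.symm.mono_left hY),
        disjoint_iff_inter_eq_empty.1 (hd.mono_left hX), union_empty, empty_union]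
    · intro Q hQ
      simp only [mem_filter, mem_powerset] at hQ
      simp only []
      rw [← inter_union_distrib_left, inter_eq_left.2 hQ.1,
        ← hgm _ _ (h.mono sdiff_subset sdiff_subset),
        ← e2 _ _ inter_subset_right inter_subset_right, ← inter_union_distrib_left,
        inter_eq_left.2 hQ.1]
  have key2 := hfm A B h
  rw [key, ← sum_excess_mul (G := G) (f := f) hg A, ← sum_excess_mul (G := G) (f := f) hg B, sum_mul_sum,
    ← sum_product', ← sub_eq_zero, ← sum_sub_distrib, sum_eq_single (A, B)] at key2
  · simp only [sdiff_self] at key2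
    rw [show g ⊥ = 1 from hg] at key2
    linear_combination key2
  · rintro ⟨X, Y⟩ hp hne
    simp only [mem_filter, mem_product, mem_powerset] at hp
    obtain ⟨⟨hX, -⟩, hY, -⟩ := hp
    have hlt : X ∪ Y ⊂ A ∪ B := by
      refine (union_subset_union hX hY).ssubset_of_ne fun he => hne ?_
      have h1 : (X ∪ Y) ∩ A = (A ∪ B) ∩ A := by rw [he]
      have h2 : (X ∪ Y) ∩ B = (A ∪ B) ∩ B := by rw [he]
      simp only [union_inter_distrib_right, inter_eq_left.2 hX,
        inter_eq_left.2 hY, disjoint_iff_inter_eq_empty.1 (hd.symm.mono_left hY),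
        disjoint_iff_inter_eq_empty.1 (hd.mono_left hX), union_empty, empty_union,
        disjoint_iff_inter_eq_empty.1 hd, disjoint_iff_inter_eq_empty.1 hd.symm, inter_self]
        at h1 h2
      rw [h1, h2]
    simp only []
    rw [ih _ (card_lt_card hlt) (h.mono hX hY) rfl]
    ring
  · intro hp
    refine absurd ?_ hp
    simp only [mem_product, mem_filter, mem_powerset, subset_rfl, sdiff_self, true_and]
    exact ⟨fun _ _ b hb => absurd hb (notMem_empty b), fun _ _ b hb => absurd hb (notMem_empty b)⟩

lemma excess_empty {f g : Finset V → R} (hf : f ∅ = 1) (hg : g ∅ = 1) :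
    G.excess f g ∅ = 1 := by
  classical
  have h := sum_excess_mul (G := G) (f := f) hg ∅
  rw [powerset_empty, sum_filter, sum_singleton, if_pos (by simp [Separated])] at h
  simpa [hf, hg] using h

/-- On a vertex set that does not split into two separated parts, the excess of `f` over `g` is
`f - g`. -/
lemma excess_eq_sub {f g : Finset V → R} (hf : f ∅ = 1) (hg : g ∅ = 1) {M : Finset V}
    (hM : M.Nonempty) (h : ∀ Q ⊆ M, G.Separated Q (M \ Q) → Q = ∅ ∨ Q = M) :
    G.excess f g M = f M - g M := by
  classical
  have h1 := sum_excess_mul (G := G) (f := f) hg M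
  have h2 : {Q ∈ M.powerset | G.Separated Q (M \ Q)} = {∅, M} := by
    ext Q
    simp only [mem_filter, mem_powerset, mem_insert, mem_singleton]
    refine ⟨fun hQ => h Q hQ.1 hQ.2, ?_⟩
    rintro (rfl | rfl) <;> simp [Separated]
  rw [h2, sum_pair hM.ne_empty.symm, excess_empty hf hg, sdiff_empty] at h1
  simp only [sdiff_self] at h1
  rw [show g ⊥ = 1 from hg] at h1
  linear_combination h1

/-- The excess of `f` over `g` is nonnegative if `f - g` is nonnegative on the vertex sets that do
not split into two separated parts. -/
lemma excess_nonneg [PartialOrder R] [IsOrderedRing R] {f g : Finset V → R}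
    (hf : f ∅ = 1) (hg : g ∅ = 1)
    (hfm : ∀ A B, G.Separated A B → f (A ∪ B) = f A * f B)
    (hgm : ∀ A B, G.Separated A B → g (A ∪ B) = g A * g B)
    (h : ∀ M : Finset V, M.Nonempty →
      (∀ Q ⊆ M, G.Separated Q (M \ Q) → Q = ∅ ∨ Q = M) → 0 ≤ f M - g M) (M : Finset V) :
    0 ≤ G.excess f g M := by
  induction M using Finset.strongInduction with
  | H M ih =>
  rcases M.eq_empty_or_nonempty with rfl | hne
  · rw [excess_empty hf hg]
    exact zero_le_one
  by_cases hM : ∀ Q ⊆ M, G.Separated Q (M \ Q) → Q = ∅ ∨ Q = M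
  · rw [excess_eq_sub hf hg hne hM]
    exact h M hne hM
  · push Not at hM
    obtain ⟨Q, hQ, hs, h0, h1⟩ := hM
    rw [← union_sdiff_of_subset hQ, excess_union hg hfm hgm hs]
    refine mul_nonneg (ih _ (hQ.ssubset_of_ne h1)) (ih _ ?_)
    exact sdiff_ssubset hQ (by simpa using h0)

open scoped Classical in
/-- Summed over all subsets `M` of `U`, the expansion of `f` by its excess over `g` leaves for each
`Q` the sum of `g` over the subsets of `U` that are separated from `Q`. -/
lemma sum_powerset_eq_sum_excess_mul {f g : Finset V → R} (hg : g ∅ = 1) (U : Finset V) :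
    ∑ M ∈ U.powerset, f M = ∑ Q ∈ U.powerset,
      G.excess f g Q * ∑ M ∈ ({u ∈ U | G.Separated Q {u}}).powerset, g M := by
  simp_rw [← sum_excess_mul (G := G) (f := f) hg, mul_sum]
  rw [sum_sigma', sum_sigma']
  refine sum_nbij' (fun p => ⟨p.2, p.1 \ p.2⟩) (fun p => ⟨p.1 ∪ p.2, p.1⟩) ?_ ?_ ?_ ?_ ?_
  · rintro ⟨M, Q⟩ h
    simp only [mem_sigma, mem_powerset, mem_filter] at h ⊢
    refine ⟨h.2.1.trans h.1, fun u hu => ?_⟩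
    simp only [mem_filter]
    refine ⟨h.1 (sdiff_subset hu), h.2.2.mono subset_rfl ?_⟩
    simpa using hu
  · rintro ⟨Q, M⟩ h
    simp only [mem_sigma, mem_powerset, mem_filter] at h ⊢
    have hs : G.Separated Q M := fun a ha b hb =>
      (mem_filter.1 (h.2 hb)).2 a ha b (mem_singleton_self b)
    refine ⟨union_subset h.1 (h.2.trans (filter_subset _ _)), subset_union_left, ?_⟩
    exact hs.mono subset_rfl (by rw [union_sdiff_left]; exact sdiff_subset)
  · rintro ⟨M, Q⟩ h
    simp only [mem_sigma, mem_powerset, mem_filter] at h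
    simp [union_eq_right.2 h.2.1]
  · rintro ⟨Q, M⟩ h
    simp only [mem_sigma, mem_powerset] at h
    have hs : G.Separated Q M := fun a ha b hb =>
      (mem_filter.1 (h.2 hb)).2 a ha b (mem_singleton_self b)
    simp only [union_sdiff_cancel_left hs.disjoint]
  · rintro ⟨M, Q⟩ h
    rfl

end Separated

/-! ### Independent sets in claw-free graphs -/

section Claw

variable {V : Type*} {G : SimpleGraph V}

open scoped Classical in
lemma ClawFree.card_filter_adj_le_two (hG : G.ClawFree) {T : Finset V}
    (hT : G.IsIndepSet (T : Set V)) (a : V) : #{b ∈ T | G.Adj a b} ≤ 2 := by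
  by_contra hlt
  obtain ⟨b, hb, c, hc, d, hd, hbc, hbd, hcd⟩ := two_lt_card.1 (not_le.1 hlt)
  simp only [mem_filter] at hb hc hd
  have nbc : ¬ G.Adj b c := hT hb.1 hc.1 hbc
  have nbd : ¬ G.Adj b d := hT hb.1 hd.1 hbd
  have ncd : ¬ G.Adj c d := hT hc.1 hd.1 hcd
  refine hG ⟨⟨⟨Sum.elim (fun _ => a) ![b, c, d], ?_⟩, ?_⟩⟩
  · rintro (i | i) (j | j) hij
    · rw [Subsingleton.elim i j]
    · fin_cases j <;> simp at hij
      exacts [absurd hij hb.2.ne, absurd hij hc.2.ne, absurd hij hd.2.ne]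
    · fin_cases i <;> simp at hij
      exacts [absurd hij hb.2.ne', absurd hij hc.2.ne', absurd hij hd.2.ne']
    · fin_cases i <;> fin_cases j <;> simp_all
  · intro i j
    change G.Adj (Sum.elim (fun _ => a) ![b, c, d] i) (Sum.elim (fun _ => a) ![b, c, d] j) ↔ _
    rcases i with i | i <;> rcases j with j | j
    · simp
    · fin_cases j <;> simp [hb.2, hc.2, hd.2]
    · fin_cases i <;> simp [hb.2.symm, hc.2.symm, hd.2.symm]
    · fin_cases i <;> fin_cases j <;>
        simp [nbc, nbd, ncd, G.adj_comm c b, G.adj_comm d b, G.adj_comm d c]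

variable [DecidableEq V]

/-- Counting the edges of the connected graph induced on `S ∪ T`: there are at least
`#(S ∪ T) - 1` of them, each has an end in `T \ S`, and in a claw-free graph a vertex of `T` has at
most two neighbours in `S`. -/
lemma ClawFree.card_le_card_add_one (hG : G.ClawFree) {S T : Finset V}
    (hS : G.IsIndepSet (S : Set V)) (hT : G.IsIndepSet (T : Set V)) (hne : (S ∪ T).Nonempty)
    (h : ∀ Q ⊆ S ∪ T, G.Separated Q ((S ∪ T) \ Q) → Q = ∅ ∨ Q = S ∪ T) : #S ≤ #T + 1 := by
  classical
  set M := S ∪ T with hM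
  let K := G.induce (M : Set V)
  obtain ⟨v, hv⟩ := hne
  let v' : (M : Set V) := ⟨v, hv⟩
  -- the vertices reachable from `v` are separated from the others
  have hconn : K.Connected := by
    rw [connected_iff_exists_forall_reachable]
    refine ⟨v', ?_⟩
    have hQ := h {u ∈ M | ∃ hu : u ∈ (M : Set V), K.Reachable v' ⟨u, hu⟩} (filter_subset _ _) ?_
    · rcases hQ with hQ | hQ
      · exact absurd (mem_filter.2 ⟨hv, hv, Reachable.refl _⟩) (hQ ▸ notMem_empty v)
      · rintro ⟨u, hu⟩
        have : u ∈ {u ∈ M | ∃ hu : u ∈ (M : Set V), K.Reachable v' ⟨u, hu⟩} := by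
          rw [hQ]; exact hu
        exact (mem_filter.1 this).2.2
    · intro a ha b hb
      rw [mem_sdiff] at hb
      refine ⟨fun e => hb.2 (e ▸ ha), fun hab => hb.2 ?_⟩
      obtain ⟨-, ha', hr⟩ := mem_filter.1 ha
      refine mem_filter.2 ⟨hb.1, hb.1, hr.trans (Adj.reachable ?_)⟩
      exact hab
  have h1 := hconn.card_vert_le_card_edgeSet_add_one
  rw [Nat.card_eq_fintype_card, Nat.card_eq_fintype_card, ← edgeFinset_card] at h1
  have hcard : Fintype.card (M : Set V) = #M := by simp
  have h2 : K.edgeFinset ⊆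
      (univ.filter fun b : (M : Set V) => (b : V) ∈ T \ S).biUnion fun b => K.incidenceFinset b := by
    intro e
    induction e using Sym2.ind with
    | _ a b =>
    intro he
    rw [mem_edgeFinset, mem_edgeSet] at he
    have hab : G.Adj a b := he
    simp only [mem_biUnion, mem_filter, mem_univ, true_and, mem_incidenceFinset]
    by_cases haS : (a : V) ∈ S
    · have hbS : (b : V) ∉ S := fun hbS => hS haS hbS hab.ne hab
      have hb : (b : V) ∈ S ∪ T := b.2
      refine ⟨b, mem_sdiff.2 ⟨(mem_union.1 hb).resolve_left hbS, hbS⟩, he, ?_⟩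
      simp
    · have ha : (a : V) ∈ S ∪ T := a.2
      refine ⟨a, mem_sdiff.2 ⟨(mem_union.1 ha).resolve_left haS, haS⟩, he, ?_⟩
      simp
  have h3 : ∀ b ∈ univ.filter (fun b : (M : Set V) => (b : V) ∈ T \ S),
      #(K.incidenceFinset b) ≤ 2 := by
    intro b hb
    rw [mem_filter, mem_sdiff] at hb
    rw [card_incidenceFinset_eq_degree, ← card_neighborFinset_eq_degree]
    refine le_trans ?_ (hG.card_filter_adj_le_two hS (b : V))
    refine card_le_card_of_injOn Subtype.val ?_ Subtype.val_injective.injOn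
    intro c hc
    rw [mem_coe, mem_neighborFinset] at hc
    have hbc : G.Adj b c := hc
    have hc' : (c : V) ∈ S ∪ T := c.2
    rw [mem_coe, mem_filter]
    exact ⟨(mem_union.1 hc').resolve_right fun hcT => hT hb.2.1 hcT hbc.ne hbc, hbc⟩
  have h4 : #(univ.filter fun b : (M : Set V) => (b : V) ∈ T \ S) ≤ #(T \ S) :=
    card_le_card_of_injOn Subtype.val (fun c hc => (mem_filter.1 hc).2)
      Subtype.val_injective.injOn
  have h5 := (card_le_card h2).trans (card_biUnion_le_card_mul _ _ 2 h3)
  have h6 : #M = #S + #(T \ S) := by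
    rw [hM, ← union_sdiff_self_eq_union, card_union_of_disjoint disjoint_sdiff]
  have h7 : #(T \ S) ≤ #T := card_le_card sdiff_subset
  omega

end Claw

/-! ### Zeros of weighted independence polynomials of claw-free graphs -/

section Stability

variable {V : Type*} [DecidableEq V] {G : SimpleGraph V}

lemma pairSum_comm {R : Type*} [CommRing R] (y y' : V → R) (M : Finset V) :
    G.pairSum y y' M = G.pairSum y' y M := by
  classical
  rw [pairSum, pairSum]
  refine sum_nbij' Prod.swap Prod.swap ?_ ?_ (fun _ _ => rfl) (fun _ _ => rfl) ?_
  · rintro ⟨S, T⟩ h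
    simp only [mem_filter, mem_product, Prod.swap] at h ⊢
    exact ⟨h.1.symm, h.2.1.symm, (union_comm _ _).trans h.2.2⟩
  · rintro ⟨S, T⟩ h
    simp only [mem_filter, mem_product, Prod.swap] at h ⊢
    exact ⟨h.1.symm, h.2.1.symm, (union_comm _ _).trans h.2.2⟩
  · rintro ⟨S, T⟩ -
    exact mul_comm _ _

/-- The gain from replacing `-|z|²` by `z²` and its conjugate, for independent sets whose sizes `m`
and `n` differ by at most one: it vanishes for `m = n`, and otherwise it is a nonnegative multiple
of `z² + z̄² + 2|z|² = (2 Re z)²`. -/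
lemma pow_add_pow_sub_nonneg (z : ℂ) {m n : ℕ} (h1 : m ≤ n + 1) (h2 : n ≤ m + 1) :
    0 ≤ (z ^ 2) ^ m * (conj z ^ 2) ^ n + (conj z ^ 2) ^ m * (z ^ 2) ^ n
      - 2 * ((-(z * conj z)) ^ m * (-(z * conj z)) ^ n) := by
  have ht : 0 ≤ z * conj z := by
    rw [Complex.mul_conj]
    exact_mod_cast Complex.normSq_nonneg z
  have hs : 0 ≤ (z + conj z) ^ 2 := by
    rw [Complex.add_conj]
    exact_mod_cast sq_nonneg (2 * z.re)
  have hnn : ∀ k : ℕ, 0 ≤ (z * conj z) ^ (2 * k) * (z + conj z) ^ 2 :=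
    fun k => mul_nonneg (pow_nonneg ht _) hs
  obtain rfl | rfl | rfl : m = n ∨ m = n + 1 ∨ n = m + 1 := by omega
  · refine le_of_eq ?_
    rw [neg_pow (z * conj z) m]
    have : ((-1 : ℂ) ^ m) * (-1) ^ m = 1 := by rw [← mul_pow]; norm_num
    ring_nf
    ring_nf at this
    rw [this]
    ring
  · convert hnn n using 1
    rw [neg_pow (z * conj z) n, neg_pow (z * conj z) (n + 1)]
    have : ((-1 : ℂ) ^ n) * (-1) ^ n = 1 := by rw [← mul_pow]; norm_num
    ring_nf
    ring_nf at this
    rw [this]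
    ring
  · convert hnn m using 1
    rw [neg_pow (z * conj z) m, neg_pow (z * conj z) (m + 1)]
    have : ((-1 : ℂ) ^ m) * (-1) ^ m = 1 := by rw [← mul_pow]; norm_num
    ring_nf
    ring_nf at this
    rw [this]
    ring

lemma ClawFree.pairSum_sub_pairSum_nonneg (hG : G.ClawFree) {w : V → ℝ} (hw : ∀ v, 0 ≤ w v) (z : ℂ)
    {M : Finset V} (hM : M.Nonempty)
    (h : ∀ Q ⊆ M, G.Separated Q (M \ Q) → Q = ∅ ∨ Q = M) :
    0 ≤ G.pairSum (fun v => w v * z ^ 2) (fun v => w v * conj z ^ 2) M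
      - G.pairSum (fun v => (w v : ℂ) * -(z * conj z)) (fun v => w v * -(z * conj z)) M := by
  classical
  -- symmetrize in `(S, T)`, so that each pair contributes a nonnegative amount
  suffices h2 : 0 ≤ G.pairSum (fun v => w v * z ^ 2) (fun v => w v * conj z ^ 2) M
      + G.pairSum (fun v => w v * conj z ^ 2) (fun v => w v * z ^ 2) M
      - 2 * G.pairSum (fun v => (w v : ℂ) * -(z * conj z)) (fun v => w v * -(z * conj z)) M by
    rw [G.pairSum_comm (fun v => (w v : ℂ) * conj z ^ 2), ← two_mul, ← mul_sub] at h2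
    have h3 : (0 : ℂ) ≤ 1 / 2 := by
      rw [Complex.le_def]; norm_num
    have := mul_nonneg h3 h2
    rwa [← mul_assoc, one_div, inv_mul_cancel₀ two_ne_zero, one_mul] at this
  rw [pairSum, pairSum, pairSum, mul_sum, ← sum_add_distrib, ← sum_sub_distrib]
  refine sum_nonneg ?_
  rintro ⟨S, T⟩ hp
  simp only [mem_filter, mem_product, mem_powerset] at hp
  obtain ⟨-, ⟨hS, hT⟩, rfl⟩ := hp
  simp only [prod_mul_distrib, prod_const]
  have hST := hG.card_le_card_add_one hS hT hM h
  rw [union_comm] at hM h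
  have hTS := hG.card_le_card_add_one hT hS hM h
  have hwn : ∀ X : Finset V, 0 ≤ ∏ v ∈ X, (w v : ℂ) := fun X =>
    prod_nonneg fun v _ => by exact_mod_cast hw v
  convert mul_nonneg (mul_nonneg (hwn S) (hwn T)) (pow_add_pow_sub_nonneg z hST hTS) using 1
  ring

lemma excess_pos_of_isIndepSet {f g : Finset V → ℂ} (hf : f ∅ = 1) (hg : g ∅ = 1)
    (hfm : ∀ A B, G.Separated A B → f (A ∪ B) = f A * f B)
    (hgm : ∀ A B, G.Separated A B → g (A ∪ B) = g A * g B)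
    (h : ∀ v, 0 < f {v} - g {v}) {Q : Finset V} (hQ : G.IsIndepSet (Q : Set V)) :
    0 < G.excess f g Q := by
  induction Q using Finset.induction_on with
  | empty =>
    rw [excess_empty hf hg]
    exact zero_lt_one
  | insert v Q hv ih =>
    have hs : G.Separated {v} Q := by
      intro a ha b hb
      rw [mem_singleton] at ha
      subst ha
      have hne : a ≠ b := fun e => hv (e ▸ hb)
      exact ⟨hne, hQ (mem_coe.2 (mem_insert_self _ _)) (mem_coe.2 (mem_insert_of_mem hb)) hne⟩
    rw [insert_eq, excess_union hg hfm hgm hs,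
      excess_eq_sub hf hg (singleton_nonempty v) fun X hX _ => subset_singleton_iff.1 hX]
    exact mul_pos (h v) (ih (hQ.anti (by simp)))

lemma pairSum_singleton {R : Type*} [CommRing R] (y y' : V → R) (v : V) :
    G.pairSum y y' {v} = y v + y' v + y v * y' v := by
  classical
  have : ((({v} : Finset V).powerset ×ˢ ({v} : Finset V).powerset).filter
      fun p : Finset V × Finset V =>
        (G.IsIndepSet (p.1 : Set V) ∧ G.IsIndepSet (p.2 : Set V)) ∧ p.1 ∪ p.2 = {v}) =
      {({v}, ∅), (∅, {v}), ({v}, {v})} := by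
    ext ⟨S, T⟩
    simp only [mem_filter, mem_product, mem_powerset, subset_singleton_iff, mem_insert,
      mem_singleton, Prod.mk.injEq]
    constructor
    · rintro ⟨⟨rfl | rfl, rfl | rfl⟩, -, h⟩ <;> simp at h ⊢
    · rintro (⟨rfl, rfl⟩ | ⟨rfl, rfl⟩ | ⟨rfl, rfl⟩) <;> simp [IsIndepSet]
  rw [pairSum, this, sum_insert, sum_insert, sum_singleton]
  · simp [add_assoc]
  · simp
  · simp

/-- The weighted independence polynomial of a claw-free graph has no zeros outside the nonpositive
real axis: these are the points `z ^ 2` with `z.re ≠ 0`. -/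
theorem ClawFree.indepSum_ne_zero (hG : G.ClawFree) {w : V → ℝ} (hw : ∀ v, 0 < w v) {z : ℂ}
    (hz : z.re ≠ 0) (U : Finset V) : G.indepSum (fun v => w v * z ^ 2) U ≠ 0 := by
  classical
  intro h0
  set f := G.pairSum (fun v => w v * z ^ 2) (fun v => w v * conj z ^ 2) with hf
  set g := G.pairSum (fun v => (w v : ℂ) * -(z * conj z)) (fun v => w v * -(z * conj z)) with hg
  have hf0 : f ∅ = 1 := pairSum_empty _ _
  have hg0 : g ∅ = 1 := pairSum_empty _ _
  have hfm : ∀ A B, G.Separated A B → f (A ∪ B) = f A * f B := fun _ _ h => pairSum_union _ _ h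
  have hgm : ∀ A B, G.Separated A B → g (A ∪ B) = g A * g B := fun _ _ h => pairSum_union _ _ h
  have hE : ∀ Q, 0 ≤ G.excess f g Q := excess_nonneg hf0 hg0 hfm hgm fun M hM h =>
    hG.pairSum_sub_pairSum_nonneg (fun v => (hw v).le) z hM h
  have hsum := sum_powerset_eq_sum_excess_mul (G := G) (f := f) hg0 U
  rw [hf, ← indepSum_mul_indepSum, h0, zero_mul, ← hf] at hsum
  -- the sum of `g` is the square of a real number
  have hsq : ∀ X : Finset V, 0 ≤ ∑ M ∈ X.powerset, g M := by
    intro X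
    rw [hg, ← indepSum_mul_indepSum]
    have : G.indepSum (fun v => (w v : ℂ) * -(z * conj z)) X =
        (G.indepSum (fun v => w v * -Complex.normSq z) X : ℝ) := by
      simp only [indepSum, Complex.mul_conj]
      push_cast
      rfl
    rw [this]
    exact_mod_cast mul_self_nonneg _
  -- a maximal independent subset of `U` contributes a positive term
  obtain ⟨Q, hQ⟩ := (U.powerset.filter
    fun S : Finset V => G.IsIndepSet (S : Set V)).exists_maximal ⟨∅, by simp [IsIndepSet]⟩
  have hQU := mem_filter.1 hQ.1
  rw [mem_powerset] at hQU
  have hfar : {u ∈ U | G.Separated Q {u}} = ∅ := by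
    refine filter_eq_empty_iff.2 fun u hu hs => ?_
    have hle := hQ.2 (y := Q ∪ {u}) (mem_filter.2 ⟨mem_powerset.2 (union_subset hQU.1
      (singleton_subset_iff.2 hu)), hs.isIndepSet_union hQU.2 (by simp [IsIndepSet])⟩)
      subset_union_left
    have hu' : u ∈ Q := hle (mem_union_right _ (mem_singleton_self u))
    exact (hs u hu' u (mem_singleton_self u)).1 rfl
  have hpos : 0 < G.excess f g Q := by
    refine excess_pos_of_isIndepSet hf0 hg0 hfm hgm (fun v => ?_) hQU.2
    rw [hf, hg, pairSum_singleton, pairSum_singleton]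
    have h1 : 0 < w v * (2 * z.re) ^ 2 := mul_pos (hw v) (by positivity)
    have h2 : (0 : ℂ) < (w v * (2 * z.re) ^ 2 : ℝ) := by exact_mod_cast h1
    convert h2 using 1
    push_cast
    have h3 := Complex.add_conj z
    push_cast at h3
    rw [← h3]
    ring
  have hterm : 0 < G.excess f g Q * ∑ M ∈ {u ∈ U | G.Separated Q {u}}.powerset, g M := by
    rw [hfar, powerset_empty, sum_singleton, hg0, mul_one]
    exact hpos
  refine ne_of_lt ?_ hsum
  exact sum_pos' (fun X _ => mul_nonneg (hE X) (hsq _)) ⟨Q, mem_powerset.2 hQU.1, hterm⟩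

end Stability

/-! ### The independence polynomial as a sum over independent sets -/

section Polynomial

variable {V W : Type*}

lemma aeval_indepPoly [Fintype V] (G : SimpleGraph V) (x : ℂ) :
    Polynomial.aeval x G.indepPoly = G.indepSum (fun _ => x) univ := by
  classical
  rw [indepPoly, map_sum, indepSum,
    ← sum_fiberwise_of_maps_to (g := fun S : Finset V => #S) (t := range (G.indepNum + 1))]
  · refine sum_congr rfl fun k _ => ?_
    rw [sum_congr rfl (g := fun _ => x ^ k) fun S hS => by
      rw [prod_const, (mem_filter.1 hS).2], sum_const, nsmul_eq_mul, map_mul, map_pow,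
      Polynomial.aeval_C, Polynomial.aeval_X, indepCount, ← Set.ncard_coe_finset]
    congr 1
    simp only [map_natCast]
    congr 2
    ext S
    simp [isNIndepSet_iff]
  · intro S hS
    rw [mem_range]
    exact Nat.lt_succ_of_le (mem_filter.1 hS).2.card_le_indepNum

lemma IsIndepSet.map_iso {G : SimpleGraph V} {G' : SimpleGraph W} (e : G ≃g G') {S : Finset V}
    (hS : G.IsIndepSet (S : Set V)) :
    G'.IsIndepSet ((S.map e.toEquiv.toEmbedding : Finset W) : Set W) := by
  intro a ha b hb hab hadj
  simp only [coe_map, Set.mem_image, mem_coe] at ha hb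
  obtain ⟨a, ha, rfl⟩ := ha
  obtain ⟨b, hb, rfl⟩ := hb
  exact hS ha hb (fun h => hab (by rw [h])) (e.map_adj_iff.1 hadj)

lemma indepSum_univ_congr [Fintype V] [Fintype W] {R : Type*} [CommRing R] {G : SimpleGraph V}
    {G' : SimpleGraph W} (e : G ≃g G') (x : R) :
    G.indepSum (fun _ => x) univ = G'.indepSum (fun _ => x) univ := by
  classical
  refine sum_nbij' (fun S => S.map e.toEquiv.toEmbedding)
    (fun S => S.map e.symm.toEquiv.toEmbedding) ?_ ?_ ?_ ?_ ?_
  · intro S hS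
    simp only [powerset_univ, mem_filter, mem_univ, true_and] at hS ⊢
    exact hS.map_iso e
  · intro S hS
    simp only [powerset_univ, mem_filter, mem_univ, true_and] at hS ⊢
    exact hS.map_iso e.symm
  · intro S _
    ext a
    simp only [mem_map_equiv]
    exact Iff.of_eq (congrArg (· ∈ S) (e.symm_apply_apply a))
  · intro S _
    ext a
    simp only [mem_map_equiv]
    exact Iff.of_eq (congrArg (· ∈ S) (e.apply_symm_apply a))
  · intro S _
    simp

lemma ClawFree.induce {G : SimpleGraph V} (hG : G.ClawFree) (s : Set V) : (G.induce s).ClawFree :=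
  fun h => hG (h.trans ⟨Embedding.induce s⟩)

lemma ClawFree.indepSum_ne_zero_of_im_ne_zero {G : SimpleGraph V} (hG : G.ClawFree) {w : V → ℝ}
    (hw : ∀ v, 0 < w v) {x : ℂ} (hx : x.im ≠ 0) (U : Finset V) :
    G.indepSum (fun v => w v * x) U ≠ 0 := by
  classical
  obtain ⟨z, rfl⟩ := IsAlgClosed.exists_pow_nat_eq x two_pos
  refine hG.indepSum_ne_zero hw (fun hz => hx ?_) U
  simp [pow_two, hz]

/-- Deletion of a vertex: `I(G) = I(G - v) + y_v I(G - N[v])`. -/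
lemma indepSum_univ_eq_add [Fintype V] {R : Type*} [CommRing R] (G : SimpleGraph V) (v : V)
    [Fintype ({v}ᶜ : Set V)] [DecidablePred fun u : ({v}ᶜ : Set V) => G.Adj v u]
    (y : V → R) :
    G.indepSum y univ = (G.induce ({v}ᶜ : Set V)).indepSum (fun u => y u) univ +
      y v * (G.induce ({v}ᶜ : Set V)).indepSum (fun u => y u) {u | ¬ G.Adj v u} := by
  classical
  have hind : ∀ S : Finset ({v}ᶜ : Set V), G.IsIndepSet ((S.map (.subtype _) : Finset V) : Set V) ↔
      (G.induce ({v}ᶜ : Set V)).IsIndepSet (S : Set ({v}ᶜ : Set V)) := by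
    intro S
    constructor
    · intro h a ha b hb hab
      exact h (mem_map_of_mem _ ha) (mem_map_of_mem _ hb) fun e => hab (Subtype.ext e)
    · intro h a ha b hb hab
      rw [mem_coe, mem_map] at ha hb
      obtain ⟨a, ha, rfl⟩ := ha
      obtain ⟨b, hb, rfl⟩ := hb
      exact h ha hb fun e => hab (by rw [e])
  have hv : ∀ S : Finset ({v}ᶜ : Set V), v ∉ S.map (.subtype (· ∈ ({v}ᶜ : Set V))) := by
    intro S h
    obtain ⟨a, -, ha⟩ := mem_map.1 h
    exact a.2 ha
  have hmap : ∀ S : Finset V, (S.subtype (· ∈ ({v}ᶜ : Set V))).map (.subtype _) = S.erase v := by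
    intro S
    ext a
    simp [and_comm]
  rw [indepSum, ← sum_filter_not_add_sum_filter _ (fun S => v ∈ S), indepSum, indepSum, mul_sum]
  congr 1
  · refine sum_nbij' (fun S => S.subtype (· ∈ ({v}ᶜ : Set V))) (fun S => S.map (.subtype _))
      ?_ ?_ ?_ ?_ ?_
    · intro S hS
      simp only [powerset_univ, mem_filter, mem_univ, true_and] at hS ⊢
      rw [← hind, hmap, erase_eq_of_notMem hS.2]
      exact hS.1
    · intro S hS
      simp only [powerset_univ, mem_filter, mem_univ, true_and] at hS ⊢
      exact ⟨(hind S).2 hS, hv S⟩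
    · intro S hS
      rw [hmap, erase_eq_of_notMem (mem_filter.1 hS).2]
    · intro S hS
      exact Finset.map_injective _ (by rw [hmap, erase_eq_of_notMem (hv S)])
    · intro S hS
      have := prod_map (S.subtype (· ∈ ({v}ᶜ : Set V))) (.subtype _) y
      rw [hmap, erase_eq_of_notMem (mem_filter.1 hS).2] at this
      exact this
  · refine sum_nbij' (fun S => S.subtype (· ∈ ({v}ᶜ : Set V)))
      (fun S => insert v (S.map (.subtype _))) ?_ ?_ ?_ ?_ ?_
    · intro S hS
      simp only [powerset_univ, mem_filter, mem_univ, true_and, mem_powerset] at hS ⊢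
      refine ⟨fun u hu => ?_, ?_⟩
      · rw [mem_subtype] at hu
        rw [mem_filter]
        exact ⟨mem_univ _, hS.1 hS.2 hu fun e => u.2 e.symm⟩
      · rw [← hind, hmap]
        exact hS.1.anti (by simp)
    · intro S hS
      simp only [powerset_univ, mem_filter, mem_univ, true_and, mem_powerset] at hS ⊢
      refine ⟨?_, mem_insert_self _ _⟩
      have hs : G.Separated {v} (S.map (.subtype (· ∈ ({v}ᶜ : Set V)))) := by
        intro a ha b hb
        rw [mem_singleton] at ha
        subst ha
        obtain ⟨b, hbS, rfl⟩ := mem_map.1 hb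
        exact ⟨fun e => b.2 e.symm, (mem_filter.1 (hS.1 hbS)).2⟩
      rw [insert_eq]
      exact hs.isIndepSet_union (by simp [IsIndepSet]) ((hind S).2 hS.2)
    · intro S hS
      rw [hmap, insert_erase (mem_filter.1 hS).2]
    · intro S hS
      exact Finset.map_injective _ (by rw [hmap, erase_insert (hv S)])
    · intro S hS
      have := prod_map (S.subtype (· ∈ ({v}ᶜ : Set V))) (.subtype _) y
      rw [hmap] at this
      rw [← mul_prod_erase S y (mem_filter.1 hS).2, this]
      rfl

/-! ### Clique cover products -/

variable {G : SimpleGraph V}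

/-- An independent set meets each clique of a clique cover at most once. -/
lemma CliqueCover.injOn_connectedComponentMk (K : G.CliqueCover) {S : Set V}
    (hS : G.IsIndepSet S) : Set.InjOn K.graph.connectedComponentMk S := by
  intro a ha b hb hab
  by_contra hne
  exact hS ha hb hne (K.le (K.isClique (K.graph.connectedComponentMk b) hab rfl hne))

open scoped Classical in
/-- Each of the `#S` cliques met by the independent set `S` leaves the vertices outside `U` in its
copy of `H`; the other copies are free. -/
lemma indepSum_cliqueCoverProduct [Fintype V] [Fintype W] {R : Type*} [CommRing R]
    (K : G.CliqueCover) [Fintype K.Cliques] (H : SimpleGraph W) (U : Set W) {N : Finset W}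
    (hN : ∀ u, u ∈ N ↔ u ∉ U) (x : R) :
    (G.cliqueCoverProduct K H U).indepSum (fun _ => x) univ =
      ∑ S ∈ univ.powerset.filter fun S : Finset V => G.IsIndepSet (S : Set V),
        x ^ #S * (H.indepSum (fun _ => x) N ^ #S *
          H.indepSum (fun _ => x) univ ^ (Fintype.card K.Cliques - #S)) := by
  -- the part of the copy of `H` at the clique `c` that is not joined to a vertex of `S`
  let free : Finset V → K.Cliques → Finset W := fun S c =>
    if ∃ a ∈ S, a ∈ c.supp then N else univ
  have hstep : ∀ S ∈ univ.powerset.filter fun S : Finset V => G.IsIndepSet (S : Set V),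
      x ^ #S * (H.indepSum (fun _ => x) N ^ #S *
          H.indepSum (fun _ => x) univ ^ (Fintype.card K.Cliques - #S)) =
      ∑ f ∈ Fintype.piFinset fun c => (free S c).powerset.filter
        fun A : Finset W => H.IsIndepSet (A : Set W), x ^ #S * ∏ c, x ^ #(f c) := by
    intro S hS
    have hinj := K.injOn_connectedComponentMk (mem_filter.1 hS).2
    have himg : univ.filter (fun c : K.Cliques => ∃ a ∈ S, a ∈ c.supp) =
        S.image K.graph.connectedComponentMk := by
      ext c
      simp
    have hnot : #(univ.filter fun c : K.Cliques => ¬ ∃ a ∈ S, a ∈ c.supp) =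
        Fintype.card K.Cliques - #S := by
      rw [filter_not, card_sdiff_of_subset (filter_subset _ _), himg, card_image_of_injOn hinj,
        card_univ]
    rw [← mul_sum, ← prod_univ_sum _ fun _ (A : Finset W) => x ^ #A]
    congr 1
    have : ∀ c : K.Cliques, ∑ A ∈ (free S c).powerset.filter
        (fun A : Finset W => H.IsIndepSet (A : Set W)), x ^ #A =
        if ∃ a ∈ S, a ∈ c.supp then H.indepSum (fun _ => x) N
          else H.indepSum (fun _ => x) univ := by
      intro c
      simp only [free, indepSum, prod_const]
      split_ifs <;> rfl
    rw [prod_congr rfl fun c _ => this c, prod_ite, prod_const, prod_const, himg,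
      card_image_of_injOn hinj, hnot]
  rw [sum_congr rfl hstep, sum_sigma', indepSum]
  refine sum_nbij' (fun T => ⟨univ.filter fun a => Sum.inl a ∈ T,
      fun c => univ.filter fun u => Sum.inr (c, u) ∈ T⟩)
    (fun p => univ.filter fun b => Sum.elim (fun a => a ∈ p.1) (fun q => q.2 ∈ p.2 q.1) b)
    ?_ ?_ ?_ ?_ ?_
  · intro T hT
    simp only [powerset_univ, mem_filter, mem_univ, true_and, mem_sigma, Fintype.mem_piFinset,
      mem_powerset] at hT ⊢
    refine ⟨fun a ha b hb hab => ?_, fun c => ⟨fun u hu => ?_, fun a ha b hb hab => ?_⟩⟩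
    · exact hT (mem_filter.1 ha).2 (mem_filter.1 hb).2 (fun e => hab (Sum.inl_injective e))
    · simp only [free]
      split_ifs with h
      · obtain ⟨a, ha, hac⟩ := h
        refine (hN u).2 fun huU => ?_
        exact hT (mem_filter.1 ha).2 (mem_filter.1 hu).2 Sum.inl_ne_inr ⟨hac, huU⟩
      · exact mem_univ u
    · exact fun hadj => hT (mem_filter.1 ha).2 (mem_filter.1 hb).2
        (fun e => hab (congrArg Prod.snd (Sum.inr_injective e))) ⟨rfl, hadj⟩
  · rintro ⟨S, f⟩ hp
    simp only [powerset_univ, mem_filter, mem_univ, true_and, mem_sigma, Fintype.mem_piFinset,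
      mem_powerset] at hp ⊢
    obtain ⟨hS, hf⟩ := hp
    have hcross : ∀ a ∈ S, ∀ c, ∀ u ∈ f c, ¬ (a ∈ c.supp ∧ u ∈ U) := by
      rintro a ha c u hu ⟨hac, huU⟩
      have h1 := (hf c).1 hu
      simp only [free] at h1
      rw [if_pos ⟨a, ha, hac⟩] at h1
      exact (hN u).1 h1 huU
    rintro (a | ⟨c, u⟩) ha (b | ⟨d, u'⟩) hb hab hadj
    · simp only [coe_filter, mem_univ, true_and, Set.mem_ofPred_eq, Sum.elim_inl] at ha hb
      exact hS ha hb (fun e => hab (by rw [e])) hadj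
    · simp only [coe_filter, mem_univ, true_and, Set.mem_ofPred_eq, Sum.elim_inl,
        Sum.elim_inr] at ha hb
      exact hcross a ha d u' hb hadj
    · simp only [coe_filter, mem_univ, true_and, Set.mem_ofPred_eq, Sum.elim_inl,
        Sum.elim_inr] at ha hb
      exact hcross b hb c u ha hadj
    · simp only [coe_filter, mem_univ, true_and, Set.mem_ofPred_eq, Sum.elim_inr] at ha hb
      obtain ⟨rfl, hadj⟩ := hadj
      exact (hf c).2 ha hb (fun e => hab (by rw [e])) hadj
  · intro T _
    ext (a | ⟨c, u⟩) <;> simp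
  · rintro ⟨S, f⟩ _
    simp
  · intro T _
    simp only [prod_const]
    rw [prod_pow_eq_pow_sum, ← pow_add]
    congr 1
    simp only [card_filter]
    rw [← Fintype.sum_prod_type' (f := fun (c : K.Cliques) u => if Sum.inr (c, u) ∈ T then 1 else 0),
      ← Fintype.sum_sum_type (fun b => if b ∈ T then 1 else 0)]
    simp

open scoped Classical in
/-- For `p ≠ 0`, the sum over the independent sets of `G` in
`indepSum_cliqueCoverProduct` is `p ^ c * I(G; x q / p)`, where `c` is the number of cliques. -/
lemma CliqueCover.sum_eq_pow_mul_indepSum [Fintype V] (K : G.CliqueCover) [Fintype K.Cliques]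
    {x p q : ℂ} (hp : p ≠ 0) :
    ∑ S ∈ univ.powerset.filter (fun S : Finset V => G.IsIndepSet (S : Set V)),
        x ^ #S * (q ^ #S * p ^ (Fintype.card K.Cliques - #S)) =
      p ^ Fintype.card K.Cliques * G.indepSum (fun _ => x * q / p) univ := by
  rw [indepSum, mul_sum]
  refine sum_congr rfl fun S hS => ?_
  have hle : #S ≤ Fintype.card K.Cliques := by
    rw [← card_image_of_injOn (K.injOn_connectedComponentMk (mem_filter.1 hS).2)]
    exact card_le_univ _
  rw [prod_const, div_pow, mul_pow, pow_sub₀ _ hp hle]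
  field_simp

lemma one_le_indepSum {R : Type*} [CommRing R] [LinearOrder R] [IsStrictOrderedRing R] {y : V → R}
    (hy : ∀ v, 0 ≤ y v) (U : Finset V) : 1 ≤ G.indepSum y U := by
  classical
  have h : (∅ : Finset V) ∈ U.powerset.filter fun S : Finset V => G.IsIndepSet (S : Set V) := by
    simp [IsIndepSet]
  have := single_le_sum (f := fun S => ∏ v ∈ S, y v) (fun S _ => prod_nonneg fun v _ => hy v) h
  rwa [prod_empty] at this

theorem cliqueCoverProduct_hasOnlyRealZeros [Finite V] [Finite W]
    {H : SimpleGraph W} (v : W) (hH : H.ClawFree) (hG : G.indepPoly.HasOnlyRealZeros)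
    (K : G.CliqueCover) :
    (G.cliqueCoverProduct K (H.induce ({v}ᶜ : Set W))
      {w : ({v}ᶜ : Set W) | (w : W) ∈ H.neighborSet v}).indepPoly.HasOnlyRealZeros := by
  classical
  cases nonempty_fintype V
  cases nonempty_fintype W
  have : Fintype K.Cliques := Fintype.ofFinite _
  intro x hx0
  by_contra hx
  rw [aeval_indepPoly, indepSum_cliqueCoverProduct K (H.induce ({v}ᶜ : Set W))
    {w : ({v}ᶜ : Set W) | (w : W) ∈ H.neighborSet v} (N := {u | ¬ H.Adj v u})
    (fun u => by simp)] at hx0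
  set p := (H.induce ({v}ᶜ : Set W)).indepSum (fun _ => x) univ with hp
  set q := (H.induce ({v}ᶜ : Set W)).indepSum (fun _ => x) {u | ¬ H.Adj v u} with hq
  have hp0 : p ≠ 0 := by
    have := (hH.induce ({v}ᶜ : Set W)).indepSum_ne_zero_of_im_ne_zero (w := fun _ => 1)
      (fun _ => one_pos) hx univ
    simpa using this
  rw [K.sum_eq_pow_mul_indepSum hp0] at hx0
  replace hx0 := (mul_eq_zero.1 hx0).resolve_left (pow_ne_zero _ hp0)
  have hreal := hG (x * q / p) (by rw [aeval_indepPoly]; exact hx0)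
  obtain ⟨r, hr⟩ : ∃ r : ℝ, (r : ℂ) = x * q / p := ⟨(x * q / p).re, by
    apply Complex.ext <;> simp [hreal]⟩
  have hr0 : r < 0 := by
    by_contra hr0
    have h1 := one_le_indepSum (G := G) (y := fun _ => r) (fun _ => not_lt.1 hr0) univ
    have h2 : ((G.indepSum (fun _ => r) univ : ℝ) : ℂ) = 0 := by
      rw [← hx0, ← hr]
      simp only [indepSum]
      push_cast
      rfl
    have h3 : G.indepSum (fun _ => r) univ = 0 := by exact_mod_cast h2
    linarith
  -- giving the root the weight `-1 / r` makes `x` a zero of the weighted polynomial of `H`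
  refine hH.indepSum_ne_zero_of_im_ne_zero (w := fun u => if u = v then -1 / r else 1)
    (fun u => ?_) hx univ ?_
  · split_ifs
    · exact div_pos_of_neg_of_neg (by norm_num) hr0
    · exact one_pos
  · rw [indepSum_univ_eq_add H v]
    have hne : ∀ u : ({v}ᶜ : Set W), (u : W) ≠ v := fun u => u.2
    simp only [hne, if_false, if_true, Complex.ofReal_one, one_mul]
    rw [← hq, ← hp]
    have hrc : (r : ℂ) ≠ 0 := by exact_mod_cast hr0.ne
    have hxq : x * q = r * p := by rw [hr]; field_simp
    push_cast
    rw [mul_assoc, hxq]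
    field_simp
    ring

/-! ### Rooted products -/

/-- The clique cover by single vertices: the spanning subgraph has no edges. -/
def CliqueCover.singletons (G : SimpleGraph V) : G.CliqueCover where
  graph := ⊥
  le := bot_le
  isClique c := by
    intro a ha b hb hab
    rw [ConnectedComponent.mem_supp_iff] at ha hb
    exact absurd (reachable_bot.1 (ConnectedComponent.exact (ha.trans hb.symm))) hab

lemma CliqueCover.singletons_out_mk (G : SimpleGraph V) (u : V) :
    Quot.out ((singletons G).graph.connectedComponentMk u) = u :=
  reachable_bot.1 (ConnectedComponent.exact (Quot.out_eq _))

/-- The rooted product is the clique cover product for the cover by single vertices. -/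
theorem nonempty_cliqueCoverProduct_singletons_iso_rootedProduct (G : SimpleGraph V)
    (H : SimpleGraph W) (v : W) :
    Nonempty (G.cliqueCoverProduct (CliqueCover.singletons G) (H.induce ({v}ᶜ : Set W))
      {w : ({v}ᶜ : Set W) | (w : W) ∈ H.neighborSet v} ≃g G.rootedProduct H v) := by
  classical
  let F : V ⊕ (CliqueCover.singletons G).Cliques × ({v}ᶜ : Set W) → V × W :=
    Sum.elim (fun u => (u, v)) (fun q => (Quot.out q.1, q.2))
  have hmk : ∀ c : (CliqueCover.singletons G).Cliques,
      (CliqueCover.singletons G).graph.connectedComponentMk (Quot.out c) = c :=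
    fun c => Quot.out_eq c
  have hF : Function.Bijective F := by
    constructor
    · rintro (a | ⟨c, x⟩) (b | ⟨d, y⟩) h
      · exact congrArg Sum.inl (Prod.ext_iff.1 h).1
      · exact absurd (Prod.ext_iff.1 h).2.symm y.2
      · exact absurd (Prod.ext_iff.1 h).2 x.2
      · have h1 : Quot.out c = Quot.out d := (Prod.ext_iff.1 h).1
        have h2 : (x : W) = y := (Prod.ext_iff.1 h).2
        rw [← hmk c, ← hmk d, h1, Subtype.ext h2]
    · rintro ⟨u, w⟩
      by_cases hw : w = v
      · exact ⟨Sum.inl u, by rw [hw]; rfl⟩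
      · exact ⟨Sum.inr ((CliqueCover.singletons G).graph.connectedComponentMk u, ⟨w, hw⟩),
          Prod.ext (CliqueCover.singletons_out_mk G u) rfl⟩
  have hsupp : ∀ (a : V) (c : (CliqueCover.singletons G).Cliques),
      a ∈ c.supp ↔ a = Quot.out c := by
    intro a c
    rw [ConnectedComponent.mem_supp_iff]
    constructor
    · rintro rfl
      exact (CliqueCover.singletons_out_mk G a).symm
    · rintro rfl
      exact hmk c
  refine ⟨⟨Equiv.ofBijective F hF, ?_⟩⟩
  rintro (a | ⟨c, x⟩) (b | ⟨d, y⟩)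
  · simp [F, rootedProduct, cliqueCoverProduct]
  · have := y.2
    simp only [Set.mem_compl_iff, Set.mem_singleton_iff] at this
    simp [F, rootedProduct, cliqueCoverProduct, hsupp, this]
  · have := x.2
    simp only [Set.mem_compl_iff, Set.mem_singleton_iff] at this
    simp [F, rootedProduct, cliqueCoverProduct, hsupp, this]
    rw [eq_comm, H.adj_comm]
  · have hx := x.2
    simp only [Set.mem_compl_iff, Set.mem_singleton_iff] at hx
    have hcd : Quot.out c = Quot.out d ↔ c = d :=
      ⟨fun h => by rw [← hmk c, ← hmk d, h], fun h => by rw [h]⟩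
    simp [F, rootedProduct, cliqueCoverProduct, hx, hcd]

end Polynomial

end SimpleGraph

theorem mainTheorem4 {V W : Type*} [Finite V] [Finite W]
    (G : SimpleGraph V) (H : SimpleGraph W) (v : W)
    (hH : H.ClawFree) (hG : G.indepPoly.HasOnlyRealZeros) :
    (∀ K : G.CliqueCover,
      (G.cliqueCoverProduct K (H.induce ({v}ᶜ : Set W))
        {w : ({v}ᶜ : Set W) | (w : W) ∈ H.neighborSet v}).indepPoly.HasOnlyRealZeros) ∧
    (G.rootedProduct H v).indepPoly.HasOnlyRealZeros := by
  refine ⟨SimpleGraph.cliqueCoverProduct_hasOnlyRealZeros v hH hG, ?_⟩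
  classical
  cases nonempty_fintype V
  cases nonempty_fintype W
  have : Fintype (SimpleGraph.CliqueCover.singletons G).Cliques := Fintype.ofFinite _
  obtain ⟨e⟩ := SimpleGraph.nonempty_cliqueCoverProduct_singletons_iso_rootedProduct G H v
  intro x hx
  refine SimpleGraph.cliqueCoverProduct_hasOnlyRealZeros v hH hG
    (SimpleGraph.CliqueCover.singletons G) x ?_
  rw [SimpleGraph.aeval_indepPoly] at hx ⊢
  rw [SimpleGraph.indepSum_univ_congr e, hx]
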